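/- Let $\nu,n,m,r\ge 0$ be integers and let $A_\ell\in\mathbb R^{n\times n}$, $B_\ell\in\mathbb R^{n\times m}$, $C_\ell\in\mathbb R^{r\times n}$, $D_\ell\in\mathbb R^{r\times m}$, $G_\ell\in\mathbb R^{m\times r}$, $V_\ell\in\mathbb R^{n\times n}$ ($\ell\in\mathbb Z^\nu$) be square summable families of matrices, with $V_{-\ell}=V_\ell^{\mathrm T}$, such that the block Toeplitz matrices $A=(A_{j-k})_{j,k\in\mathbb Z^\nu}$, $B$, $C$, $D$, $G$, $V$ (defined likewise) specify bounded operators between the real Hilbert spaces $\mathfrak X=\ell^2(\mathbb Z^\nu,\mathbb R^n)$ (states), $\mathfrak U=\ell^2(\mathbb Z^\nu,\mathbb R^m)$ (inputs) and $\mathfrak Y=\ell^2(\mathbb Z^\nu,\mathbb R^r)$ (outputs). For $M$ any of these let $\mathcal M(\sigma)=\sum_{\ell\in\mathbb Z^\nu}e^{-i\ell^{\mathrm T}\sigma}M_\ell$ be the corresponding Fourier series, convergent in $L^2$ of the torus $\mathbb T^\nu=(\mathbb R/2\pi\mathbb Z)^\nu$ and so defined for almost every $\sigma$; this gives $\mathcal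 A,\mathcal B,\mathcal C,\mathcal D,\mathcal G,\mathcal V$. Put $$N(\sigma)=\begin{bmatrix}-\mathcal A(\sigma)^*\mathcal V(\sigma)-\mathcal V(\sigma)\mathcal A(\sigma) & \mathcal C(\sigma)^*\mathcal G(\sigma)^*-\mathcal V(\sigma)\mathcal B(\sigma)\\ \mathcal G(\sigma)\mathcal C(\sigma)-\mathcal B(\sigma)^*\mathcal V(\sigma) & \mathcal G(\sigma)\mathcal D(\sigma)+\mathcal D(\sigma)^*\mathcal G(\sigma)^*\end{bmatrix}.$$ For an initial state $x_0\in\mathfrak X$ and a locally integrable input $u:[0,\infty)\to\mathfrak U$ (that is, $\int_0^T\|u(t)\|_2\,dt<\infty$ for all $T>0$), let $x$ be the continuous solution of $x(t)=x_0+\int_0^t(Ax(\tau)+Bu(\tau))\,d\tau$, $t\ge 0$, and put $y=Cx+Du$, $S(t)=\langle u(t),Gy(t)\rangle$ (supply rate) and $H(t)=\tfrac12\langle x(t),Vx(t)\rangle$ (energy). Then: (a) for all such $x_0$ and $u$, $H$ is differentiable at almost every $t>0$, so that the energy dissipation rate $S(t)-\dot H(t)$ is defined for almost every $t>0$; (b)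 if $N(\sigma)$ is positive semidefinite for almost every $\sigma\in\mathbb T^\nu$, then for all such $x_0$ and $u$ one has $S(t)-\dot H(t)\ge 0$ for almost every $t>0$; (c) if the pair $(\mathcal A(\sigma),\mathcal B(\sigma))$ is controllable for almost every $\sigma\in\mathbb T^\nu$ (that is, $[\mathcal B,\mathcal A\mathcal B,\dots,\mathcal A^{n-1}\mathcal B](\sigma)$ has rank $n$), then $S(t)-\dot H(t)\ge 0$ holds for almost every $t>0$ for all such $x_0$ and $u$ if and only if $N(\sigma)$ is positive semidefinite for almost every $\sigma\in\mathbb T^\nu$. -/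

import Mathlib

open MeasureTheory
open scoped ComplexOrder Matrix

noncomputable section

namespace LatticeNet

/-- The integer lattice `ℤ^ν`. -/
abbrev Lattice (ν : ℕ) : Type := Fin ν → ℤ

/-- The real Hilbert space of square summable functions on the lattice with values in `ℝ^p`;
its inner product is `⟪f, g⟫ = ∑ₖ fₖᵀ gₖ`. -/
abbrev Sig (ν p : ℕ) : Type := lp (fun _ : Lattice ν => EuclideanSpace ℝ (Fin p)) 2

/-- A real `p × q` matrix attached to every (relative) lattice location. -/
abbrev MatSeq (ν p q : ℕ) : Type := Lattice ν → Matrix (Fin p) (Fin q) ℝ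

/-- Square summability `∑_ℓ ‖M_ℓ‖² < ∞` (with the Frobenius norm). -/
def SquareSummable {ν p q : ℕ} (M : MatSeq ν p q) : Prop :=
  Summable fun ℓ => ∑ i, ∑ j, (M ℓ i j) ^ 2

/-- `L` is the operator of the block Toeplitz matrix `(M_{j-k})_{j,k}`. -/
def IsToeplitz {ν p q : ℕ} (M : MatSeq ν p q) (L : Sig ν q →L[ℝ] Sig ν p) : Prop :=
  ∀ (f : Sig ν q) (j : Lattice ν),
    HasSum (fun k => Matrix.toEuclideanLin (M (j - k)) (f k)) (L f j)

/-- The block Toeplitz matrix `(M_{j-k})_{j,k}` specifies a bounded operator on square summable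
functions. -/
def IsBoundedToeplitz {ν p q : ℕ} (M : MatSeq ν p q) : Prop :=
  ∃ L : Sig ν q →L[ℝ] Sig ν p, IsToeplitz M L

open Classical in
/-- The bounded operator specified by the block Toeplitz matrix `(M_{j-k})_{j,k}`
(it is unique when it exists; `0` if the matrix does not specify a bounded operator). -/
def toeplitz {ν p q : ℕ} (M : MatSeq ν p q) : Sig ν q →L[ℝ] Sig ν p :=
  if h : IsBoundedToeplitz M then h.choose else 0

theorem toeplitz_spec {ν p q : ℕ} {M : MatSeq ν p q} (h : IsBoundedToeplitz M) :
    IsToeplitz M (toeplitz M) := by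
  unfold toeplitz
  rw [dif_pos h]
  exact h.choose_spec

/-- The normalized Haar (Lebesgue) measure on the torus. -/
abbrev torusMeasure (ν : ℕ) : Measure (UnitAddTorus (Fin ν)) :=
  Measure.pi fun _ => AddCircle.haarAddCircle

/-- The Fourier series `∑_ℓ e^{-i ℓᵀ σ} M_ℓ`, entrywise as a sum in `L²` of the torus.
The torus is parametrized by `θ ∈ (ℝ/ℤ)^ν`, with `σ = 2πθ`, so that
`mFourier (-ℓ) θ = e^{-2πi ℓᵀθ} = e^{-i ℓᵀσ}`. The values are meaningful for almost every `θ`. -/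
def symbol {ν p q : ℕ} (M : MatSeq ν p q) (θ : UnitAddTorus (Fin ν)) :
    Matrix (Fin p) (Fin q) ℂ :=
  Matrix.of fun i j =>
    (∑' ℓ : Lattice ν, ((M ℓ i j : ℝ) : ℂ) • UnitAddTorus.mFourierLp 2 (-ℓ) :
      Lp ℂ 2 (torusMeasure ν)) θ

/-- Controllability of a matrix pair: `[B, AB, …, A^{n-1}B]` has full row rank. -/
def Controllable {n m : ℕ} (A : Matrix (Fin n) (Fin n) ℂ) (B : Matrix (Fin n) (Fin m) ℂ) : Prop :=
  (Matrix.of fun (i : Fin n) (q : Fin n × Fin m) => (A ^ (q.1 : ℕ) * B) i q.2).rank = n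

/-- The data of a translation invariant network: state-space matrices `A, B, C, D`, the matrices
`G` of the supply rate and `V` of the energy. -/
structure Network (ν n m r : ℕ) where
  A : MatSeq ν n n
  B : MatSeq ν n m
  C : MatSeq ν r n
  D : MatSeq ν r m
  G : MatSeq ν m r
  V : MatSeq ν n n

variable {ν n m r : ℕ}

/-- Local integrability in time of an input on `[0, ∞)`: `∫₀ᵀ ‖u(t)‖₂ dt < ∞` for all `T > 0`. -/
def Admissible (u : ℝ → Sig ν m) : Prop :=
  ∀ T : ℝ, 0 < T → IntegrableOn u (Set.Ioc 0 T)

namespace Network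

/-- `x` is the network state produced by the initial state `x₀` and the input `u`: a continuous
solution on `[0, ∞)` of `ẋ = A x + B u`, understood as a Volterra integral equation. -/
structure IsState (P : Network ν n m r) (x₀ : Sig ν n) (u : ℝ → Sig ν m) (x : ℝ → Sig ν n) :
    Prop where
  continuousOn : ContinuousOn x (Set.Ici 0)
  eq_integral : ∀ t : ℝ, 0 ≤ t →
    x t = x₀ + ∫ τ in (0 : ℝ)..t, (toeplitz P.A (x τ) + toeplitz P.B (u τ))

/-- The output `y = C x + D u`. -/
def output (P : Network ν n m r) (u : ℝ → Sig ν m) (x : ℝ → Sig ν n) (t : ℝ) : Sig ν r :=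
  toeplitz P.C (x t) + toeplitz P.D (u t)

/-- The supply rate `S(t) = ⟪u(t), G y(t)⟫`. -/
def supply (P : Network ν n m r) (u : ℝ → Sig ν m) (x : ℝ → Sig ν n) (t : ℝ) : ℝ :=
  inner ℝ (u t) (toeplitz P.G (P.output u x t))

/-- The energy `H(t) = ½ ⟪x(t), V x(t)⟫`. -/
def energy (P : Network ν n m r) (x : ℝ → Sig ν n) (t : ℝ) : ℝ :=
  (1 / 2) * inner ℝ (x t) (toeplitz P.V (x t))

/-- The energy dissipation rate `S(t) - Ḣ(t)`. -/
def dissipationRate (P : Network ν n m r) (u : ℝ → Sig ν m) (x : ℝ → Sig ν n) (t : ℝ) : ℝ :=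
  P.supply u x t - deriv (P.energy x) t

/-- The dissipation rate is nonnegative (at almost every time) for all square summable initial
states and all locally integrable inputs. -/
def Dissipative (P : Network ν n m r) : Prop :=
  ∀ (x₀ : Sig ν n) (u : ℝ → Sig ν m) (x : ℝ → Sig ν n), Admissible u → P.IsState x₀ u x →
    ∀ᵐ t ∂(volume.restrict (Set.Ioi (0 : ℝ))), 0 ≤ P.dissipationRate u x t

/-- The matrix `N(σ)`, `σ = 2πθ`. -/
def N (P : Network ν n m r) (θ : UnitAddTorus (Fin ν)) :
    Matrix (Fin n ⊕ Fin m) (Fin n ⊕ Fin m) ℂ :=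
  Matrix.fromBlocks
    (-((symbol P.A θ)ᴴ * symbol P.V θ) - symbol P.V θ * symbol P.A θ)
    ((symbol P.C θ)ᴴ * (symbol P.G θ)ᴴ - symbol P.V θ * symbol P.B θ)
    (symbol P.G θ * symbol P.C θ - (symbol P.B θ)ᴴ * symbol P.V θ)
    (symbol P.G θ * symbol P.D θ + (symbol P.D θ)ᴴ * (symbol P.G θ)ᴴ)

end Network

end LatticeNet

end

/-! By translation invariance the spatial Fourier transform turns each block Toeplitz operator into
multiplication by its symbol (`hat_toeplitz`). Since $V$ is self-adjoint, the product rule shows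
that along any trajectory the dissipation rate is, at almost every time, the value at $(x(t),u(t))$
of one fixed quadratic form $Q(x,u)=\langle u,G(Cx+Du)\rangle-\langle x,V(Ax+Bu)\rangle$
(`Regular.ae_dissipationRate_eq`). By Parseval, $2Q$ is the integral over the torus of the pointwise
form of $N(\sigma)$, so $N\ge 0$ almost everywhere gives $Q\ge 0$ and dissipativity.

Conversely, the initial state and the initial input are free, so every pair $(x_0,u_0)$ is the
time-zero value of a trajectory, and continuity in time forces $Q(x_0,u_0)\ge 0$
(`Regular.dissipationForm_nonneg`). To localise this in $\sigma$, real signals do not suffice, as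
their transforms carry a conjugation symmetry. But $Q(x_1,u_1)+Q(x_2,u_2)$ is the form at the
complex signals $x_1+ix_2$, $u_1+iu_2$, whose transforms exhaust $L^2$ (`exists_hatC_eq`). Testing
with constant vectors on arbitrary measurable sets gives $N\ge 0$ almost everywhere. -/

noncomputable section

namespace LatticeNet

open Filter Topology
open scoped ComplexConjugate

/-! ### Fourier series on the torus: uniqueness, Parseval, convolution. -/

section FourierSeries

variable {ν : ℕ}

/-- An integrable function on the torus whose Fourier coefficients all vanish is zero almost
everywhere. -/
theorem ae_eq_zero_of_integral_mFourier_mul_eq_zero {h : UnitAddTorus (Fin ν) → ℂ}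
    (hh : Integrable h (torusMeasure ν))
    (h0 : ∀ n : Lattice ν, ∫ θ, UnitAddTorus.mFourier n θ * h θ ∂(torusMeasure ν) = 0) :
    h =ᵐ[torusMeasure ν] 0 := by
  have hint (φ : C(UnitAddTorus (Fin ν), ℂ)) :
      Integrable (fun θ => φ θ * h θ) (torusMeasure ν) :=
    hh.bdd_mul φ.continuous.aestronglyMeasurable (Eventually.of_forall φ.norm_coe_le_norm)
  have hcont : Continuous fun φ : C(UnitAddTorus (Fin ν), ℂ) =>
      ∫ θ, φ θ * h θ ∂(torusMeasure ν) := by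
    refine (LinearMap.mkContinuous
      { toFun := fun φ : C(UnitAddTorus (Fin ν), ℂ) => ∫ θ, φ θ * h θ ∂(torusMeasure ν)
        map_add' := fun φ ψ => ?_
        map_smul' := fun c φ => ?_ } (∫ θ, ‖h θ‖ ∂(torusMeasure ν)) fun φ => ?_ :
        C(UnitAddTorus (Fin ν), ℂ) →L[ℂ] ℂ).continuous
    · simp only [ContinuousMap.add_apply, add_mul]
      exact integral_add (hint φ) (hint ψ)
    · simp only [ContinuousMap.smul_apply, smul_eq_mul, mul_assoc, RingHom.id_apply]
      exact integral_const_mul c _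
    · simp only [LinearMap.coe_mk, AddHom.coe_mk]
      rw [mul_comm, ← integral_const_mul]
      refine norm_integral_le_of_norm_le (hh.norm.const_mul _) (Eventually.of_forall fun θ => ?_)
      rw [norm_mul]
      gcongr
      exact φ.norm_coe_le_norm θ
  -- Trigonometric polynomials are uniformly dense, so a continuous functional vanishing on the
  -- characters vanishes.
  have hall (φ : C(UnitAddTorus (Fin ν), ℂ)) : ∫ θ, φ θ * h θ ∂(torusMeasure ν) = 0 := by
    have hmem : φ ∈ closure (Submodule.span ℂ
        (Set.range (UnitAddTorus.mFourier (d := Fin ν))) : Set C(UnitAddTorus (Fin ν), ℂ)) := by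
      rw [← Submodule.topologicalClosure_coe, UnitAddTorus.span_mFourier_closure_eq_top]
      trivial
    refine closure_minimal (t := (fun φ : C(UnitAddTorus (Fin ν), ℂ) =>
      ∫ θ, φ θ * h θ ∂(torusMeasure ν)) ⁻¹' {0}) (fun ψ hψ => ?_)
      (isClosed_singleton.preimage hcont) hmem
    induction hψ using Submodule.span_induction with
    | mem _ hx => obtain ⟨n, rfl⟩ := hx; exact h0 n
    | zero => simp
    | add φ ψ _ _ hφ hψ =>
      simp only [Set.mem_preimage, Set.mem_singleton_iff, ContinuousMap.add_apply, add_mul] at *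
      rw [integral_add (hint φ) (hint ψ), hφ, hψ, add_zero]
    | smul c φ _ hφ =>
      simp only [Set.mem_preimage, Set.mem_singleton_iff, ContinuousMap.smul_apply,
        smul_eq_mul, mul_assoc] at *
      rw [integral_const_mul, hφ, mul_zero]
  -- Indicators of closed sets are pointwise limits of continuous functions bounded by 1, so
  -- dominated convergence carries the vanishing over to integrals over closed sets.
  refine ae_eq_zero_of_forall_setIntegral_isClosed_eq_zero hh fun s hs => ?_
  let φ (k : ℕ) : C(UnitAddTorus (Fin ν), ℂ) :=
    ⟨fun θ => ((hs.apprSeq k θ : ℝ) : ℂ), by fun_prop⟩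
  have hlim : Tendsto (fun k => ∫ θ, φ k θ * h θ ∂(torusMeasure ν)) atTop
      (𝓝 (∫ θ, s.indicator h θ ∂(torusMeasure ν))) := by
    refine tendsto_integral_of_dominated_convergence (fun θ => ‖h θ‖)
      (fun k => (hint (φ k)).aestronglyMeasurable) hh.norm (fun k => ?_) ?_
    · refine Eventually.of_forall fun θ => ?_
      rw [norm_mul]
      refine mul_le_of_le_one_left (norm_nonneg _) ?_
      have := HasOuterApproxClosed.apprSeq_apply_le_one hs k θ
      simpa [φ] using this
    · refine Eventually.of_forall fun θ => ?_
      have h1 := tendsto_pi_nhds.1 (HasOuterApproxClosed.tendsto_apprSeq hs) θ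
      have h2 : Tendsto (fun k => φ k θ) atTop 
          (𝓝 (((s.indicator (fun _ => (1 : NNReal)) θ : NNReal) : ℝ) : ℂ)) :=
        ((Complex.continuous_ofReal.comp NNReal.continuous_coe).tendsto _).comp h1
      have h3 := h2.mul_const (h θ)
      by_cases hθ : θ ∈ s <;> simpa [hθ] using h3
  rw [integral_indicator hs.measurableSet] at hlim
  simp only [hall] at hlim
  exact tendsto_nhds_unique hlim tendsto_const_nhds

/-- The Hilbert basis `θ ↦ e^{-2πi ℓᵀθ}` of `L²` of the torus. -/
def expBasis (ν : ℕ) : HilbertBasis (Lattice ν) ℂ (Lp ℂ 2 (torusMeasure ν)) :=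
  HilbertBasis.mk (v := fun ℓ => UnitAddTorus.mFourierLp 2 (-ℓ))
    (UnitAddTorus.orthonormal_mFourier.comp _ neg_injective) (by
      have h := UnitAddTorus.span_mFourierLp_closure_eq_top (d := Fin ν) (p := 2) (by simp)
      have hr : Set.range (fun ℓ : Lattice ν => UnitAddTorus.mFourierLp 2 (-ℓ))
          = Set.range (UnitAddTorus.mFourierLp (d := Fin ν) 2) :=
        (Equiv.neg (Lattice ν)).surjective.range_comp (UnitAddTorus.mFourierLp 2)
      exact (congrArg (fun s => (Submodule.span ℂ s).topologicalClosure) hr |>.trans h).ge)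

theorem expBasis_apply (ℓ : Lattice ν) : expBasis ν ℓ = UnitAddTorus.mFourierLp 2 (-ℓ) :=
  congrFun (HilbertBasis.coe_mk _ _) ℓ

/-- The function `∑_ℓ a_ℓ e^{-2πi ℓᵀθ}` with real coefficients. -/
def fourierSeries (a : Lattice ν → ℝ) : Lp ℂ 2 (torusMeasure ν) :=
  ∑' ℓ, (a ℓ : ℂ) • UnitAddTorus.mFourierLp 2 (-ℓ)

theorem symbol_apply {p q : ℕ} (M : MatSeq ν p q) (θ : UnitAddTorus (Fin ν)) (i : Fin p)
    (j : Fin q) : symbol M θ i j = fourierSeries (fun ℓ => M ℓ i j) θ := rfl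

theorem memℓp_ofReal {a : Lattice ν → ℝ} (ha : Summable fun ℓ => a ℓ ^ 2) :
    Memℓp (fun ℓ => (a ℓ : ℂ)) 2 := by
  refine memℓp_gen ?_
  simpa using ha

theorem fourierSeries_eq {a : Lattice ν → ℝ} (ha : Summable fun ℓ => a ℓ ^ 2) :
    fourierSeries a = (expBasis ν).repr.symm ⟨fun ℓ => (a ℓ : ℂ), memℓp_ofReal ha⟩ := by
  have h := (expBasis ν).hasSum_repr_symm ⟨fun ℓ => (a ℓ : ℂ), memℓp_ofReal ha⟩
  simp only [expBasis_apply] at h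
  exact h.tsum_eq

/-- The inner product conjugates its first argument, which turns the basis vector with exponent $-n$
back into the character $n$. -/
theorem integral_mFourier_mul (f : Lp ℂ 2 (torusMeasure ν)) (n : Lattice ν) :
    ∫ θ, UnitAddTorus.mFourier n θ * f θ ∂(torusMeasure ν) = (expBasis ν).repr f n := by
  rw [HilbertBasis.repr_apply_apply, MeasureTheory.L2.inner_def, expBasis_apply]
  refine integral_congr_ae ?_
  filter_upwards [UnitAddTorus.coeFn_mFourierLp 2 (-n)] with θ hθ
  rw [hθ, RCLike.inner_apply, UnitAddTorus.mFourier_neg, Complex.conj_conj, mul_comm]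

theorem integral_mFourier_mul_fourierSeries {a : Lattice ν → ℝ} (ha : Summable fun ℓ => a ℓ ^ 2)
    (n : Lattice ν) :
    ∫ θ, UnitAddTorus.mFourier n θ * fourierSeries a θ ∂(torusMeasure ν) = a n := by
  rw [integral_mFourier_mul, fourierSeries_eq ha, LinearIsometryEquiv.apply_symm_apply]

theorem hasSum_inner_fourierSeries {a b : Lattice ν → ℝ} (ha : Summable fun ℓ => a ℓ ^ 2)
    (hb : Summable fun ℓ => b ℓ ^ 2) :
    HasSum (fun ℓ => ((a ℓ * b ℓ : ℝ) : ℂ)) (inner ℂ (fourierSeries a) (fourierSeries b)) := by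
  rw [fourierSeries_eq ha, fourierSeries_eq hb, LinearIsometryEquiv.inner_map_map]
  have := lp.hasSum_inner (𝕜 := ℂ) (⟨fun ℓ => (a ℓ : ℂ), memℓp_ofReal ha⟩ : lp (fun _ => ℂ) 2)
    ⟨fun ℓ => (b ℓ : ℂ), memℓp_ofReal hb⟩
  simpa [mul_comm] using this

theorem integrable_L2 (f : Lp ℂ 2 (torusMeasure ν)) : Integrable f (torusMeasure ν) :=
  (Lp.memLp f).integrable one_le_two

theorem integrable_mul_L2 (f g : Lp ℂ 2 (torusMeasure ν)) :
    Integrable (fun θ => f θ * g θ) (torusMeasure ν) :=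
  (Lp.memLp f).integrable_mul (Lp.memLp g)

theorem integrable_mFourier_mul {h : UnitAddTorus (Fin ν) → ℂ} (hh : Integrable h (torusMeasure ν))
    (n : Lattice ν) : Integrable (fun θ => UnitAddTorus.mFourier n θ * h θ) (torusMeasure ν) :=
  hh.bdd_mul (UnitAddTorus.mFourier n).continuous.aestronglyMeasurable
    (Eventually.of_forall (UnitAddTorus.mFourier n).norm_coe_le_norm)

/-- Integrable functions with the same Fourier coefficients agree almost everywhere. -/
theorem ae_eq_of_integral_mFourier_mul_eq {g h : UnitAddTorus (Fin ν) → ℂ}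
    (hg : Integrable g (torusMeasure ν)) (hh : Integrable h (torusMeasure ν))
    (H : ∀ n : Lattice ν, ∫ θ, UnitAddTorus.mFourier n θ * g θ ∂(torusMeasure ν)
      = ∫ θ, UnitAddTorus.mFourier n θ * h θ ∂(torusMeasure ν)) :
    g =ᵐ[torusMeasure ν] h := by
  have := ae_eq_zero_of_integral_mFourier_mul_eq_zero (hg.sub hh) fun n => by
    simp only [Pi.sub_apply, mul_sub]
    rw [integral_sub (integrable_mFourier_mul hg n) (integrable_mFourier_mul hh n), H, sub_self]
  filter_upwards [this] with θ hθ
  simpa [sub_eq_zero] using hθ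

theorem summable_sub_left {a : Lattice ν → ℝ} (ha : Summable fun ℓ => a ℓ ^ 2) (j : Lattice ν) :
    Summable fun k => a (j - k) ^ 2 :=
  (Equiv.subLeft j).summable_iff.2 ha

/-- For real coefficients, conjugating the series reflects the index and multiplying by a character
shifts it. This lets a convolution be written as an $L^2$ inner product. -/
theorem fourierSeries_sub_left {a : Lattice ν → ℝ} (ha : Summable fun ℓ => a ℓ ^ 2)
    (j : Lattice ν) :
    (fourierSeries fun k => a (j - k)) =ᵐ[torusMeasure ν]
      fun θ => UnitAddTorus.mFourier (-j) θ * conj (fourierSeries a θ) := by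
  have hc : Integrable (fun θ => conj (fourierSeries a θ)) (torusMeasure ν) :=
    (Complex.conjLIE.integrable_comp_iff).2 (integrable_L2 _)
  refine ae_eq_of_integral_mFourier_mul_eq (integrable_L2 _) (integrable_mFourier_mul hc _)
    fun n => ?_
  rw [integral_mFourier_mul_fourierSeries (summable_sub_left ha j)]
  have : ∀ θ, UnitAddTorus.mFourier n θ * (UnitAddTorus.mFourier (-j) θ * conj (fourierSeries a θ))
      = conj (UnitAddTorus.mFourier (j - n) θ * fourierSeries a θ) := fun θ => by
    rw [map_mul, ← UnitAddTorus.mFourier_neg, ← mul_assoc, ← UnitAddTorus.mFourier_add]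
    congr 3; abel
  simp only [this]
  rw [integral_conj, integral_mFourier_mul_fourierSeries ha, Complex.conj_ofReal]

/-- The Fourier coefficients of a product are given by convolution. -/
theorem hasSum_integral_mFourier_mul_mul {a b : Lattice ν → ℝ} (ha : Summable fun ℓ => a ℓ ^ 2)
    (hb : Summable fun ℓ => b ℓ ^ 2) (j : Lattice ν) :
    HasSum (fun k => ((a (j - k) * b k : ℝ) : ℂ))
      (∫ θ, UnitAddTorus.mFourier j θ * (fourierSeries a θ * fourierSeries b θ)
        ∂(torusMeasure ν)) := by
  have := hasSum_inner_fourierSeries (summable_sub_left ha j) hb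
  rw [MeasureTheory.L2.inner_def] at this
  convert this using 1
  refine integral_congr_ae ?_
  filter_upwards [fourierSeries_sub_left ha j] with θ hθ
  rw [hθ, RCLike.inner_apply, map_mul, Complex.conj_conj, UnitAddTorus.mFourier_neg,
    Complex.conj_conj]
  ring

end FourierSeries

/-! ### Spatial Fourier transform of signals; Toeplitz operators as multipliers. -/

section FourierTransform

variable {ν p q : ℕ}

theorem hasSum_fourierSeries {a : Lattice ν → ℝ} (ha : Summable fun ℓ => a ℓ ^ 2) :
    HasSum (fun ℓ => (a ℓ : ℂ) • expBasis ν ℓ) (fourierSeries a) := by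
  rw [fourierSeries_eq ha]
  exact (expBasis ν).hasSum_repr_symm ⟨fun ℓ => (a ℓ : ℂ), memℓp_ofReal ha⟩

theorem summable_sq_apply (f : Sig ν p) (i : Fin p) : Summable fun ℓ => (f ℓ i) ^ 2 := by
  have h := (lp.memℓp f).summable (by simp)
  refine Summable.of_nonneg_of_le (fun ℓ => sq_nonneg _) (fun ℓ => ?_) h
  simp only [ENNReal.toReal_ofNat, Real.rpow_ofNat]
  rw [EuclideanSpace.norm_sq_eq]
  refine le_trans (by simp) (Finset.single_le_sum (f := fun j => ‖f ℓ j‖ ^ 2)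
    (fun j _ => by positivity) (Finset.mem_univ i))

theorem SquareSummable.apply {M : MatSeq ν p q} (hM : SquareSummable M) (i : Fin p) (j : Fin q) :
    Summable fun ℓ => M ℓ i j ^ 2 := by
  refine Summable.of_nonneg_of_le (fun ℓ => sq_nonneg _) (fun ℓ => ?_) hM
  exact (Finset.single_le_sum (f := fun j => M ℓ i j ^ 2) (fun j _ => sq_nonneg _)
    (Finset.mem_univ j)).trans (Finset.single_le_sum (f := fun i => ∑ j, M ℓ i j ^ 2)
    (fun i _ => Finset.sum_nonneg fun j _ => sq_nonneg _) (Finset.mem_univ i))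

/-- The components of the spatial Fourier transform of a square summable signal. -/
def hat (f : Sig ν p) (i : Fin p) : Lp ℂ 2 (torusMeasure ν) := fourierSeries fun ℓ => f ℓ i

theorem hat_add (f g : Sig ν p) (i : Fin p) : hat (f + g) i = hat f i + hat g i := by
  refine (hasSum_fourierSeries (summable_sq_apply (f + g) i)).unique ?_
  refine ((hasSum_fourierSeries (summable_sq_apply f i)).add
    (hasSum_fourierSeries (summable_sq_apply g i))).congr_fun fun ℓ => ?_
  rw [← add_smul, ← Complex.ofReal_add]
  rfl

theorem sum_inner_hat (f g : Sig ν p) :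
    ∑ i, inner ℂ (hat f i) (hat g i) = ((inner ℝ f g : ℝ) : ℂ) := by
  have h1 := hasSum_sum (s := Finset.univ) fun i _ =>
    hasSum_inner_fourierSeries (summable_sq_apply f i) (summable_sq_apply g i)
  refine h1.unique ?_
  have h2 := Complex.hasSum_ofReal.2 (lp.hasSum_inner (𝕜 := ℝ) f g)
  simpa [PiLp.inner_apply, mul_comm] using h2

/-- A block Toeplitz operator acts as multiplication by its symbol in the Fourier domain. -/
theorem hat_toeplitz {M : MatSeq ν p q} (hM : SquareSummable M) (hM' : IsBoundedToeplitz M)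
    (f : Sig ν q) (i : Fin p) :
    hat (toeplitz M f) i =ᵐ[torusMeasure ν] fun θ => (symbol M θ *ᵥ fun j => hat f j θ) i := by
  -- The entries of the symbol are only known to be in $L^2$, so the products are a priori only in
  -- $L^1$; hence the comparison of coefficients for integrable functions.
  have hint (j : Fin q) := integrable_mul_L2 (fourierSeries fun ℓ => M ℓ i j) (hat f j)
  refine ae_eq_of_integral_mFourier_mul_eq (integrable_L2 _) ?_ fun k => ?_
  · simp only [Matrix.mulVec, dotProduct, symbol_apply]
    exact integrable_finsetSum _ fun j _ => hint j
  · simp only [Matrix.mulVec, dotProduct, symbol_apply, Finset.mul_sum]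
    rw [integral_finsetSum _ fun j _ => integrable_mFourier_mul (hint j) k, hat,
      integral_mFourier_mul_fourierSeries (summable_sq_apply _ i)]
    have h1 := hasSum_sum (s := Finset.univ) fun j _ =>
      hasSum_integral_mFourier_mul_mul (hM.apply i j) (summable_sq_apply f j) k
    refine HasSum.unique ?_ h1
    have h2 := (toeplitz_spec hM' f k).mapL (EuclideanSpace.proj i : _ →L[ℝ] ℝ)
    have h3 := Complex.hasSum_ofReal.2 h2
    simpa [Matrix.mulVec, dotProduct] using h3

/-- The spatial Fourier transform of the complex valued signal `f + i g`. -/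
def hatC (f g : Sig ν p) (i : Fin p) : Lp ℂ 2 (torusMeasure ν) := hat f i + Complex.I • hat g i

theorem hatC_add (f₁ f₂ g₁ g₂ : Sig ν p) (i : Fin p) :
    hatC (f₁ + g₁) (f₂ + g₂) i = hatC f₁ f₂ i + hatC g₁ g₂ i := by
  simp only [hatC, hat_add, smul_add]
  abel

theorem hatC_coeFn (f g : Sig ν p) (i : Fin p) :
    hatC f g i =ᵐ[torusMeasure ν] fun θ => hat f i θ + Complex.I * hat g i θ := by
  filter_upwards [Lp.coeFn_add (hat f i) (Complex.I • hat g i), Lp.coeFn_smul Complex.I (hat g i)]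
    with θ h1 h2
  rw [hatC, h1, Pi.add_apply, h2, Pi.smul_apply, smul_eq_mul]

theorem hatC_toeplitz {M : MatSeq ν p q} (hM : SquareSummable M) (hM' : IsBoundedToeplitz M)
    (f g : Sig ν q) :
    ∀ᵐ θ ∂(torusMeasure ν), (fun i => hatC (toeplitz M f) (toeplitz M g) i θ)
      = symbol M θ *ᵥ fun j => hatC f g j θ := by
  have h1 : ∀ᵐ θ ∂(torusMeasure ν), ∀ i, hat (toeplitz M f) i θ = _ :=
    ae_all_iff.2 fun i => hat_toeplitz hM hM' f i
  have h2 : ∀ᵐ θ ∂(torusMeasure ν), ∀ i, hat (toeplitz M g) i θ = _ :=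
    ae_all_iff.2 fun i => hat_toeplitz hM hM' g i
  have h3 : ∀ᵐ θ ∂(torusMeasure ν), ∀ i, hatC (toeplitz M f) (toeplitz M g) i θ = _ :=
    ae_all_iff.2 fun i => hatC_coeFn _ _ i
  have h4 : ∀ᵐ θ ∂(torusMeasure ν), ∀ i, hatC f g i θ = _ := ae_all_iff.2 fun i => hatC_coeFn _ _ i
  filter_upwards [h1, h2, h3, h4] with θ h1 h2 h3 h4
  ext i
  rw [h3, h1, h2]
  simp only [h4, Matrix.mulVec, dotProduct, mul_add, Finset.sum_add_distrib, Finset.mul_sum]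
  congr 1
  exact Finset.sum_congr rfl fun j _ => by ring

theorem hatC_add_coeFn (f₁ f₂ g₁ g₂ : Sig ν p) :
    ∀ᵐ θ ∂(torusMeasure ν), (fun i => hatC (f₁ + g₁) (f₂ + g₂) i θ)
      = (fun i => hatC f₁ f₂ i θ) + fun i => hatC g₁ g₂ i θ := by
  have h : ∀ᵐ θ ∂(torusMeasure ν), ∀ i, (hatC f₁ f₂ i + hatC g₁ g₂ i) θ = _ :=
    ae_all_iff.2 fun i => Lp.coeFn_add _ _
  filter_upwards [h] with θ h
  ext i
  rw [hatC_add, h]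
  rfl

theorem integrable_star_dotProduct (Φ Ψ : Fin p → Lp ℂ 2 (torusMeasure ν)) :
    Integrable (fun θ => star (fun i => Φ i θ) ⬝ᵥ fun i => Ψ i θ) (torusMeasure ν) := by
  refine integrable_finsetSum _ fun i _ => ?_
  have := L2.integrable_inner (𝕜 := ℂ) (Φ i) (Ψ i)
  simpa [mul_comm] using this

/-- The real part of Parseval's identity for complex valued signals. -/
theorem integral_re_hatC (f₁ f₂ g₁ g₂ : Sig ν p) :
    ∫ θ, (star (fun i => hatC f₁ f₂ i θ) ⬝ᵥ fun i => hatC g₁ g₂ i θ).re ∂(torusMeasure ν)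
      = inner ℝ f₁ g₁ + inner ℝ f₂ g₂ := by
  have h1 : ∫ θ, (star (fun i => hatC f₁ f₂ i θ) ⬝ᵥ fun i => hatC g₁ g₂ i θ) ∂(torusMeasure ν)
      = ∑ i, inner ℂ (hatC f₁ f₂ i) (hatC g₁ g₂ i) := by
    simp only [dotProduct]
    rw [integral_finsetSum]
    · refine Finset.sum_congr rfl fun i _ => ?_
      rw [L2.inner_def]
      simp [mul_comm]
    · intro i _
      have := L2.integrable_inner (𝕜 := ℂ) (hatC f₁ f₂ i) (hatC g₁ g₂ i)
      simpa [mul_comm] using this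
  -- The two cross terms are purely imaginary and disappear on taking real parts.
  have h2 : ∑ i, inner ℂ (hatC f₁ f₂ i) (hatC g₁ g₂ i)
      = ((inner ℝ f₁ g₁ : ℝ) : ℂ) + Complex.I * ((inner ℝ f₁ g₂ : ℝ) : ℂ)
        - Complex.I * ((inner ℝ f₂ g₁ : ℝ) : ℂ) + ((inner ℝ f₂ g₂ : ℝ) : ℂ) := by
    simp only [← sum_inner_hat, Finset.mul_sum, ← Finset.sum_add_distrib, ← Finset.sum_sub_distrib]
    refine Finset.sum_congr rfl fun i _ => ?_
    simp only [hatC, inner_add_left, inner_add_right, inner_smul_left, inner_smul_right,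
      Complex.conj_I]
    linear_combination -(inner ℂ (hat f₂ i) (hat g₂ i)) * Complex.I_mul_I
  have h3 := integral_re (integrable_star_dotProduct (hatC f₁ f₂) (hatC g₁ g₂))
  simp only [RCLike.re_eq_complex_re] at h3
  rw [h3, h1, h2]
  simp

/-- Every square integrable vector valued function on the torus is the Fourier transform of a
complex valued signal. -/
theorem exists_hatC_eq (Φ : Fin p → Lp ℂ 2 (torusMeasure ν)) : ∃ f g : Sig ν p, hatC f g = Φ := by
  -- Used with the real and the imaginary part of the Fourier coefficients; the bound on `φ` ensures
  -- square summability.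
  have key (φ : ℂ → ℝ) (hφ : ∀ z, φ z ^ 2 ≤ ‖z‖ ^ 2) :
      ∃ f : Sig ν p, ∀ ℓ i, f ℓ i = φ ((expBasis ν).repr (Φ i) ℓ) := by
    refine ⟨⟨fun ℓ => WithLp.toLp 2 fun i => φ ((expBasis ν).repr (Φ i) ℓ), memℓp_gen ?_⟩,
      fun ℓ i => rfl⟩
    simp only [ENNReal.toReal_ofNat, Real.rpow_ofNat, EuclideanSpace.norm_sq_eq]
    refine summable_sum fun i _ => ?_
    have h := (lp.memℓp ((expBasis ν).repr (Φ i))).summable (by simp)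
    refine Summable.of_nonneg_of_le (fun ℓ => by positivity) (fun ℓ => ?_) h
    simpa using hφ _
  obtain ⟨f, hf⟩ := key Complex.re fun z => by
    rw [← Complex.normSq_eq_norm_sq, Complex.normSq_apply]; nlinarith [sq_nonneg z.im]
  obtain ⟨g, hg⟩ := key Complex.im fun z => by
    rw [← Complex.normSq_eq_norm_sq, Complex.normSq_apply]; nlinarith [sq_nonneg z.re]
  refine ⟨f, g, funext fun i => ?_⟩
  have h := (hasSum_fourierSeries (summable_sq_apply f i)).add
    ((hasSum_fourierSeries (summable_sq_apply g i)).const_smul Complex.I)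
  refine h.unique ?_
  have h' := (expBasis ν).hasSum_repr (Φ i)
  refine h'.congr_fun fun ℓ => ?_
  simp only [hf, hg, smul_smul, ← add_smul]
  congr 1
  rw [mul_comm Complex.I]
  exact Complex.re_add_im _

/-- Reflecting the index conjugates each entry of the symbol, while by hypothesis it transposes the
coefficients. -/
theorem symbol_isHermitian {V : MatSeq ν p p} (hV : SquareSummable V)
    (hVsymm : ∀ ℓ, V (-ℓ) = (V ℓ)ᵀ) : ∀ᵐ θ ∂(torusMeasure ν), (symbol V θ).IsHermitian := by
  have h : ∀ᵐ θ ∂(torusMeasure ν), ∀ ij : Fin p × Fin p,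
      (fourierSeries fun ℓ => V (0 - ℓ) ij.1 ij.2) θ = _ :=
    ae_all_iff.2 fun ij => fourierSeries_sub_left (hV.apply ij.1 ij.2) 0
  filter_upwards [h] with θ h
  ext i j
  have := h (j, i)
  simp only [zero_sub, neg_zero, UnitAddTorus.mFourier_zero, ContinuousMap.one_apply, one_mul,
    hVsymm, Matrix.transpose_apply] at this
  rw [Matrix.conjTranspose_apply, symbol_apply, symbol_apply, this]
  rfl

end FourierTransform

/-! ### The dissipation form and its symbol $N$. -/

section DissipationForm

variable {ν n m r : ℕ}

namespace Network

/-- The quadratic form `⟪u, G (C x + D u)⟫ - ⟪x, V (A x + B u)⟫` of the energy dissipation rate. -/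
def dissipationForm (P : Network ν n m r) (x : Sig ν n) (u : Sig ν m) : ℝ :=
  inner ℝ u (toeplitz P.G (toeplitz P.C x + toeplitz P.D u))
    - inner ℝ x (toeplitz P.V (toeplitz P.A x + toeplitz P.B u))

/-- The quadratic form of `N(σ)` is twice the real part of the symbol of the dissipation form. -/
theorem star_dotProduct_N_mulVec (P : Network ν n m r) {θ : UnitAddTorus (Fin ν)}
    (hV : (symbol P.V θ).IsHermitian) (x : Fin n → ℂ) (u : Fin m → ℂ) :
    star (Sum.elim x u) ⬝ᵥ (P.N θ *ᵥ Sum.elim x u) =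
      ((2 * ((star u ⬝ᵥ symbol P.G θ *ᵥ (symbol P.C θ *ᵥ x + symbol P.D θ *ᵥ u)).re
        - (star x ⬝ᵥ symbol P.V θ *ᵥ (symbol P.A θ *ᵥ x + symbol P.B θ *ᵥ u)).re) : ℝ) : ℂ) := by
  -- Twice a real part is a number plus its conjugate, so both sides become sums of sesquilinear
  -- terms that can be matched.
  have hre (z w : ℂ) : ((2 * (z.re - w.re) : ℝ) : ℂ) = (z - w) + star (z - w) := by
    rw [Complex.star_def, Complex.add_conj]; push_cast [Complex.sub_re]; ring
  have hadj {p q : ℕ} (M : Matrix (Fin p) (Fin q) ℂ) (a : Fin p → ℂ) (b : Fin q → ℂ) :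
      star (star a ⬝ᵥ M *ᵥ b) = star b ⬝ᵥ Mᴴ *ᵥ a := by
    rw [← Matrix.star_dotProduct, Matrix.star_mulVec, ← Matrix.dotProduct_mulVec]
  rw [hre]
  simp only [Matrix.mulVec_add, dotProduct_add, Matrix.mulVec_mulVec, star_sub, star_add, hadj,
    Matrix.conjTranspose_mul, hV.eq]
  rw [N, Matrix.fromBlocks_mulVec, Function.star_sumElim, sumElim_dotProduct_sumElim]
  simp only [Sum.elim_comp_inl, Sum.elim_comp_inr, Matrix.add_mulVec, Matrix.sub_mulVec,
    Matrix.neg_mulVec, dotProduct_add, dotProduct_sub, dotProduct_neg]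
  ring

theorem N_isHermitian (P : Network ν n m r) {θ : UnitAddTorus (Fin ν)}
    (hV : (symbol P.V θ).IsHermitian) : (P.N θ).IsHermitian := by
  rw [N, Matrix.isHermitian_fromBlocks_iff]
  refine ⟨?_, ?_, ?_, ?_⟩
  · simp [Matrix.IsHermitian, hV.eq]; abel
  · simp [hV.eq]
  · simp [hV.eq]
  · simp [Matrix.IsHermitian]; abel

/-- The spatial Fourier transform of the pair of complex valued signals `x₁ + i x₂`,
`u₁ + i u₂`. -/
def pairHat (x₁ x₂ : Sig ν n) (u₁ u₂ : Sig ν m) (θ : UnitAddTorus (Fin ν)) :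
    Fin n ⊕ Fin m → ℂ :=
  Sum.elim (fun i => hatC x₁ x₂ i θ) (fun i => hatC u₁ u₂ i θ)

/-- The standing assumptions on a network: square summable matrices which specify bounded block
Toeplitz operators, with a symmetric energy matrix. -/
structure Regular (P : Network ν n m r) : Prop where
  sqA : SquareSummable P.A
  sqB : SquareSummable P.B
  sqC : SquareSummable P.C
  sqD : SquareSummable P.D
  sqG : SquareSummable P.G
  sqV : SquareSummable P.V
  bddA : IsBoundedToeplitz P.A
  bddB : IsBoundedToeplitz P.B
  bddC : IsBoundedToeplitz P.C
  bddD : IsBoundedToeplitz P.D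
  bddG : IsBoundedToeplitz P.G
  bddV : IsBoundedToeplitz P.V
  symmV : ∀ ℓ : Lattice ν, P.V (-ℓ) = (P.V ℓ)ᵀ

namespace Regular

variable {P : Network ν n m r}

/-- The quadratic form of `N` as a function on the torus, through the operators of the network. -/
theorem star_pairHat_dotProduct_N_ae_eq (hP : P.Regular) (x₁ x₂ : Sig ν n) (u₁ u₂ : Sig ν m) :
    (fun θ => (star (pairHat x₁ x₂ u₁ u₂ θ) ⬝ᵥ (P.N θ *ᵥ pairHat x₁ x₂ u₁ u₂ θ)).re)
      =ᵐ[torusMeasure ν] fun θ => 2 *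
        ((star (fun i => hatC u₁ u₂ i θ) ⬝ᵥ fun i =>
          hatC (toeplitz P.G (toeplitz P.C x₁ + toeplitz P.D u₁))
            (toeplitz P.G (toeplitz P.C x₂ + toeplitz P.D u₂)) i θ).re
        - (star (fun i => hatC x₁ x₂ i θ) ⬝ᵥ fun i =>
          hatC (toeplitz P.V (toeplitz P.A x₁ + toeplitz P.B u₁))
            (toeplitz P.V (toeplitz P.A x₂ + toeplitz P.B u₂)) i θ).re) := by
  filter_upwards [symbol_isHermitian hP.sqV hP.symmV, hatC_toeplitz hP.sqA hP.bddA x₁ x₂,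
    hatC_toeplitz hP.sqB hP.bddB u₁ u₂, hatC_toeplitz hP.sqC hP.bddC x₁ x₂,
    hatC_toeplitz hP.sqD hP.bddD u₁ u₂,
    hatC_toeplitz hP.sqG hP.bddG (toeplitz P.C x₁ + toeplitz P.D u₁)
      (toeplitz P.C x₂ + toeplitz P.D u₂),
    hatC_toeplitz hP.sqV hP.bddV (toeplitz P.A x₁ + toeplitz P.B u₁)
      (toeplitz P.A x₂ + toeplitz P.B u₂),
    hatC_add_coeFn (toeplitz P.C x₁) (toeplitz P.C x₂) (toeplitz P.D u₁) (toeplitz P.D u₂),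
    hatC_add_coeFn (toeplitz P.A x₁) (toeplitz P.A x₂) (toeplitz P.B u₁) (toeplitz P.B u₂)]
    with θ h hA hB hC hD hG hV h1 h2
  rw [hG, hV, h1, h2, hA, hB, hC, hD, pairHat, star_dotProduct_N_mulVec P h, Complex.ofReal_re]

/-- Integrability comes from the rewriting through the bounded operators, as products of $L^2$
functions; it is not read off from the entries of $N$. -/
theorem integrable_star_pairHat_dotProduct_N (hP : P.Regular) (x₁ x₂ : Sig ν n) (u₁ u₂ : Sig ν m) :
    Integrable (fun θ =>
      (star (pairHat x₁ x₂ u₁ u₂ θ) ⬝ᵥ (P.N θ *ᵥ pairHat x₁ x₂ u₁ u₂ θ)).re) (torusMeasure ν) := by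
  refine Integrable.congr (Integrable.const_mul (Integrable.sub ?_ ?_) 2)
    (hP.star_pairHat_dotProduct_N_ae_eq x₁ x₂ u₁ u₂).symm
  · exact (integrable_star_dotProduct _ _).re
  · exact (integrable_star_dotProduct _ _).re

/-- The dissipation form in the Fourier domain. -/
theorem integral_star_pairHat_dotProduct_N (hP : P.Regular) (x₁ x₂ : Sig ν n) (u₁ u₂ : Sig ν m) :
    ∫ θ, (star (pairHat x₁ x₂ u₁ u₂ θ) ⬝ᵥ (P.N θ *ᵥ pairHat x₁ x₂ u₁ u₂ θ)).re ∂(torusMeasure ν)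
      = 2 * (P.dissipationForm x₁ u₁ + P.dissipationForm x₂ u₂) := by
  rw [integral_congr_ae (hP.star_pairHat_dotProduct_N_ae_eq x₁ x₂ u₁ u₂), integral_const_mul,
    integral_sub, integral_re_hatC, integral_re_hatC, dissipationForm, dissipationForm]
  · ring
  · exact (integrable_star_dotProduct _ _).re
  · exact (integrable_star_dotProduct _ _).re

theorem dissipationForm_nonneg_of_posSemidef (hP : P.Regular)
    (hN : ∀ᵐ θ ∂(torusMeasure ν), (P.N θ).PosSemidef) (x : Sig ν n) (u : Sig ν m) :
    0 ≤ P.dissipationForm x u := by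
  -- With equal real and imaginary parts the integral is four times the dissipation form.
  have h := hP.integral_star_pairHat_dotProduct_N x x u u
  have h0 : 0 ≤ ∫ θ, (star (pairHat x x u u θ) ⬝ᵥ (P.N θ *ᵥ pairHat x x u u θ)).re
      ∂(torusMeasure ν) := by
    refine integral_nonneg_of_ae ?_
    filter_upwards [hN] with θ hθ
    exact (Complex.le_def.1 (hθ.dotProduct_mulVec_nonneg _)).1
  linarith

/-- Signals whose transform is a constant vector $c$ on a measurable set $s$ and zero elsewhere show
that $c^*Nc$ has nonnegative real integral over every $s$. -/
theorem posSemidef_of_dissipationForm_nonneg (hP : P.Regular)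
    (hQ : ∀ x u, 0 ≤ P.dissipationForm x u) :
    ∀ᵐ θ ∂(torusMeasure ν), (P.N θ).PosSemidef := by
  have key (s : Set (UnitAddTorus (Fin ν))) (hs : MeasurableSet s) (c : Fin n ⊕ Fin m → ℂ) :
      ∃ (x₁ x₂ : Sig ν n) (u₁ u₂ : Sig ν m), pairHat x₁ x₂ u₁ u₂
        =ᵐ[torusMeasure ν] s.indicator fun _ => c := by
    obtain ⟨x₁, x₂, hx⟩ := exists_hatC_eq (ν := ν) fun i : Fin n =>
      indicatorConstLp 2 hs (measure_ne_top _ _) (c (Sum.inl i))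
    obtain ⟨u₁, u₂, hu⟩ := exists_hatC_eq (ν := ν) fun i : Fin m =>
      indicatorConstLp 2 hs (measure_ne_top _ _) (c (Sum.inr i))
    refine ⟨x₁, x₂, u₁, u₂, ?_⟩
    have h1 : ∀ᵐ θ ∂(torusMeasure ν), ∀ i, hatC x₁ x₂ i θ = s.indicator (fun _ => c (.inl i)) θ :=
      ae_all_iff.2 fun i => by rw [hx]; exact indicatorConstLp_coeFn
    have h2 : ∀ᵐ θ ∂(torusMeasure ν), ∀ i, hatC u₁ u₂ i θ = s.indicator (fun _ => c (.inr i)) θ :=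
      ae_all_iff.2 fun i => by rw [hu]; exact indicatorConstLp_coeFn
    filter_upwards [h1, h2] with θ h1 h2
    ext (i | i)
    · by_cases hθ : θ ∈ s <;> simp [pairHat, h1, hθ]
    · by_cases hθ : θ ∈ s <;> simp [pairHat, h2, hθ]
  have hc (c : Fin n ⊕ Fin m → ℂ) :
      ∀ᵐ θ ∂(torusMeasure ν), 0 ≤ (star c ⬝ᵥ (P.N θ *ᵥ c)).re := by
    refine ae_nonneg_of_forall_setIntegral_nonneg ?_ fun s hs _ => ?_
    · obtain ⟨x₁, x₂, u₁, u₂, h⟩ := key Set.univ MeasurableSet.univ c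
      refine (hP.integrable_star_pairHat_dotProduct_N x₁ x₂ u₁ u₂).congr ?_
      filter_upwards [h] with θ hθ
      simp [hθ]
    · obtain ⟨x₁, x₂, u₁, u₂, h⟩ := key s hs c
      rw [← integral_indicator hs]
      have h' := hP.integral_star_pairHat_dotProduct_N x₁ x₂ u₁ u₂
      have he : ∫ θ, s.indicator (fun θ => (star c ⬝ᵥ (P.N θ *ᵥ c)).re) θ ∂(torusMeasure ν)
          = ∫ θ, (star (pairHat x₁ x₂ u₁ u₂ θ) ⬝ᵥ (P.N θ *ᵥ pairHat x₁ x₂ u₁ u₂ θ)).re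
            ∂(torusMeasure ν) := by
        refine integral_congr_ae ?_
        filter_upwards [h] with θ hθ
        rw [hθ]
        by_cases hs : θ ∈ s <;> simp [hs]
      rw [he, h']
      linarith [hQ x₁ u₁, hQ x₂ u₂]
  -- The exceptional null set depends on the vector: a countable dense family leaves a single null
  -- set, and continuity of the form in `c` reaches all vectors.
  have hd := ae_all_iff.2 fun k => hc (TopologicalSpace.denseSeq (Fin n ⊕ Fin m → ℂ) k)
  filter_upwards [hd, symbol_isHermitian hP.sqV hP.symmV] with θ hd hθ
  refine Matrix.PosSemidef.of_dotProduct_mulVec_nonneg (P.N_isHermitian hθ) fun c => ?_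
  have hre : 0 ≤ (star c ⬝ᵥ (P.N θ *ᵥ c)).re := by
    refine (TopologicalSpace.denseRange_denseSeq (Fin n ⊕ Fin m → ℂ)).induction_on
      (p := fun c => 0 ≤ (star c ⬝ᵥ (P.N θ *ᵥ c)).re) c ?_ hd
    refine isClosed_le continuous_const (Complex.continuous_re.comp ?_)
    exact continuous_star.dotProduct (continuous_const.matrix_mulVec continuous_id)
  -- The form is real valued, so nonnegativity of its real part is nonnegativity in the order of ℂ.
  have hq := P.star_dotProduct_N_mulVec hθ (c ∘ Sum.inl) (c ∘ Sum.inr)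
  rw [Sum.elim_comp_inl_inr] at hq
  rw [hq, Complex.ofReal_re] at hre
  rw [hq]
  exact_mod_cast hre

end Regular

end Network

end DissipationForm

/-! ### Trajectories: differentiability of the energy, and reaching arbitrary pairs. -/

section Trajectories

variable {ν n m r : ℕ}

/-- The symbol is Hermitian almost everywhere. Parseval is applied to $f+if$ and $g+ig$, which
doubles both sides. -/
theorem inner_toeplitz_left_eq_right {V : MatSeq ν n n} (hV : SquareSummable V)
    (hV' : IsBoundedToeplitz V) (hVsymm : ∀ ℓ, V (-ℓ) = (V ℓ)ᵀ) (f g : Sig ν n) :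
    inner ℝ (toeplitz V f) g = inner ℝ f (toeplitz V g) := by
  have h1 := integral_re_hatC (toeplitz V f) (toeplitz V f) g g
  have h2 := integral_re_hatC f f (toeplitz V g) (toeplitz V g)
  have h : ∫ θ, (star (fun i => hatC (toeplitz V f) (toeplitz V f) i θ) ⬝ᵥ
        fun i => hatC g g i θ).re ∂(torusMeasure ν)
      = ∫ θ, (star (fun i => hatC f f i θ) ⬝ᵥ
        fun i => hatC (toeplitz V g) (toeplitz V g) i θ).re ∂(torusMeasure ν) := by
    refine integral_congr_ae ?_
    filter_upwards [symbol_isHermitian hV hVsymm, hatC_toeplitz hV hV' f f,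
      hatC_toeplitz hV hV' g g] with θ hθ hf hg
    rw [hf, hg, Matrix.star_mulVec, hθ.eq, Matrix.dotProduct_mulVec]
  linarith

namespace Network

variable {P : Network ν n m r} {x₀ : Sig ν n} {u : ℝ → Sig ν m} {x : ℝ → Sig ν n}

/-- The state of a network has the expected derivative at almost every time. -/
theorem IsState.ae_hasDerivAt (hx : P.IsState x₀ u x) (hu : Admissible u) :
    ∀ᵐ t ∂(volume.restrict (Set.Ioi (0 : ℝ))),
      HasDerivAt x (toeplitz P.A (x t) + toeplitz P.B (u t)) t := by
  have hint (T : ℝ) (hT : 0 < T) : IntervalIntegrable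
      (fun τ => toeplitz P.A (x τ) + toeplitz P.B (u τ)) volume 0 T := by
    refine IntervalIntegrable.add ?_ ?_
    · refine ContinuousOn.intervalIntegrable ?_
      refine (toeplitz P.A).continuous.comp_continuousOn (hx.continuousOn.mono ?_)
      rw [Set.uIcc_of_le hT.le]
      exact fun t ht => ht.1
    · rw [intervalIntegrable_iff_integrableOn_Ioc_of_le hT.le]
      exact (toeplitz P.B).integrable_comp (hu T hT)
  -- Lebesgue differentiation applies on each bounded interval $[0,k+1]$; countably many null sets
  -- are discarded.
  have h := ae_all_iff.2 fun k : ℕ => (hint (k + 1) (by positivity)).ae_hasDerivAt_integral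
  rw [ae_restrict_iff' measurableSet_Ioi]
  filter_upwards [h] with t ht ht0
  obtain ⟨k, hk⟩ := exists_nat_gt t
  have h0 : (0 : ℝ) ≤ k + 1 := by positivity
  have hd := ht k (by rw [Set.uIcc_of_le h0]; exact ⟨ht0.le, by linarith⟩) 0 (by simp)
  refine (hd.const_add x₀).congr_of_eventuallyEq ?_
  filter_upwards [Ioi_mem_nhds ht0] with s hs
  exact hx.eq_integral s (le_of_lt hs)

/-- The product rule gives two terms, equal by self-adjointness of $V$, which cancels the factor ½.
-/
theorem Regular.ae_hasDerivAt_energy (hP : P.Regular) (hx : P.IsState x₀ u x)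
    (hu : Admissible u) :
    ∀ᵐ t ∂(volume.restrict (Set.Ioi (0 : ℝ))), HasDerivAt (P.energy x)
      (inner ℝ (x t) (toeplitz P.V (toeplitz P.A (x t) + toeplitz P.B (u t)))) t := by
  filter_upwards [hx.ae_hasDerivAt hu] with t ht
  have h := (ht.inner ℝ ((toeplitz P.V).hasFDerivAt.comp_hasDerivAt t ht)).const_mul (1 / 2 : ℝ)
  refine h.congr_deriv ?_
  simp only [Function.comp_apply]
  rw [← inner_toeplitz_left_eq_right hP.sqV hP.bddV hP.symmV (toeplitz P.A (x t) + _),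
    real_inner_comm (x t)]
  ring

/-- Along every trajectory, the dissipation rate is the dissipation form at almost every time. -/
theorem Regular.ae_dissipationRate_eq (hP : P.Regular) (hx : P.IsState x₀ u x)
    (hu : Admissible u) :
    ∀ᵐ t ∂(volume.restrict (Set.Ioi (0 : ℝ))),
      P.dissipationRate u x t = P.dissipationForm (x t) (u t) := by
  filter_upwards [hP.ae_hasDerivAt_energy hx hu] with t ht
  rw [dissipationRate, ht.deriv]
  rfl

/-- Every initial state and every initial value of the input belong to a trajectory with a
continuous input. -/
theorem exists_isState (P : Network ν n m r) (x₀ : Sig ν n) (u₀ : Sig ν m) :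
    ∃ (u : ℝ → Sig ν m) (x : ℝ → Sig ν n), Continuous u ∧ Continuous x ∧ x 0 = x₀ ∧ u 0 = u₀ ∧
      P.IsState x₀ u x := by
  -- The zero second component keeps the input constant in time, so state and input together solve
  -- the autonomous linear equation $\dot z=Kz$.
  let K : (Sig ν n × Sig ν m) →L[ℝ] (Sig ν n × Sig ν m) :=
    ((toeplitz P.A).coprod (toeplitz P.B)).prod 0
  let z (t : ℝ) : Sig ν n × Sig ν m := NormedSpace.exp (t • K) (x₀, u₀)
  have hz (t : ℝ) : HasDerivAt z (K (z t)) t := by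
    have h := hasDerivAt_exp_smul_const' K t
    exact h.clm_apply (hasDerivAt_const t (x₀, u₀)) |>.congr_deriv (by simp [z])
  have hzc : Continuous z := continuous_iff_continuousAt.2 fun t => (hz t).continuousAt
  have h0 : z 0 = (x₀, u₀) := by simp [z]
  refine ⟨fun t => (z t).2, fun t => (z t).1, hzc.snd, hzc.fst, by simp [h0], by simp [h0],
    hzc.fst.continuousOn, fun t _ => ?_⟩
  have hd (s : ℝ) : HasDerivAt (fun t => (z t).1)
      (toeplitz P.A (z s).1 + toeplitz P.B (z s).2) s := (hz s).fst
  have hi := intervalIntegral.integral_eq_sub_of_hasDerivAt (a := 0) (b := t)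
    (fun s _ => hd s) (Continuous.intervalIntegrable (by fun_prop) _ _)
  rw [hi, h0]
  simp

/-- Dissipativity says nothing at the single time 0, but along a trajectory with continuous input
the form is continuous in time: a negative value at 0 would persist on an interval $(0,\varepsilon)$
of positive measure. -/
theorem Regular.dissipationForm_nonneg (hP : P.Regular) (h : P.Dissipative) (x₀ : Sig ν n)
    (u₀ : Sig ν m) : 0 ≤ P.dissipationForm x₀ u₀ := by
  obtain ⟨u, x, huc, hxc, rfl, rfl, hx⟩ := P.exists_isState x₀ u₀
  have hu : Admissible u := fun T _ => huc.integrableOn_Ioc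
  have hae : ∀ᵐ t ∂(volume.restrict (Set.Ioi (0 : ℝ))), 0 ≤ P.dissipationForm (x t) (u t) := by
    filter_upwards [hP.ae_dissipationRate_eq hx hu, h _ u x hu hx] with t h1 h2
    rwa [← h1]
  have hcont : Continuous fun t => P.dissipationForm (x t) (u t) := by
    unfold dissipationForm
    fun_prop
  by_contra hneg
  obtain ⟨ε, hε, hball⟩ := Metric.eventually_nhds_iff.1
    (hcont.continuousAt.eventually_lt continuousAt_const (not_le.1 hneg))
  rw [ae_restrict_iff' measurableSet_Ioi] at hae
  have hpos : volume (Set.Ioo 0 ε) ≠ 0 := by simpa using hε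
  refine hpos (measure_mono_null (fun t ht => ?_) (ae_iff.1 hae))
  have : dist t 0 < ε := by rw [Real.dist_eq, sub_zero, abs_of_pos ht.1]; exact ht.2
  have := hball this
  simp only [Set.mem_ofPred_eq, not_forall, not_le]
  exact ⟨ht.1, this⟩

end Network

end Trajectories

end LatticeNet

end

/-! ### The dissipativity criterion. -/

theorem theorem1 {ν n m r : ℕ} (P : LatticeNet.Network ν n m r)
    (hA : LatticeNet.SquareSummable P.A) (hB : LatticeNet.SquareSummable P.B)
    (hC : LatticeNet.SquareSummable P.C) (hD : LatticeNet.SquareSummable P.D)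
    (hG : LatticeNet.SquareSummable P.G) (hV : LatticeNet.SquareSummable P.V)
    (hA' : LatticeNet.IsBoundedToeplitz P.A) (hB' : LatticeNet.IsBoundedToeplitz P.B)
    (hC' : LatticeNet.IsBoundedToeplitz P.C) (hD' : LatticeNet.IsBoundedToeplitz P.D)
    (hG' : LatticeNet.IsBoundedToeplitz P.G) (hV' : LatticeNet.IsBoundedToeplitz P.V)
    (hVsymm : ∀ ℓ : LatticeNet.Lattice ν, P.V (-ℓ) = (P.V ℓ)ᵀ) :
    -- the energy is differentiable at almost every time, so that the dissipation rate makes sense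
    (∀ (x₀ : LatticeNet.Sig ν n) (u : ℝ → LatticeNet.Sig ν m) (x : ℝ → LatticeNet.Sig ν n),
      LatticeNet.Admissible u → P.IsState x₀ u x →
        ∀ᵐ t ∂(MeasureTheory.volume.restrict (Set.Ioi (0 : ℝ))), DifferentiableAt ℝ (P.energy x) t) ∧
    -- sufficiency, without controllability
    ((∀ᵐ θ ∂(LatticeNet.torusMeasure ν), (P.N θ).PosSemidef) → P.Dissipative) ∧
    -- the criterion under controllability
    ((∀ᵐ θ ∂(LatticeNet.torusMeasure ν),
        LatticeNet.Controllable (LatticeNet.symbol P.A θ) (LatticeNet.symbol P.B θ)) →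
      (P.Dissipative ↔ ∀ᵐ θ ∂(LatticeNet.torusMeasure ν), (P.N θ).PosSemidef)) := by
  have hP : P.Regular := ⟨hA, hB, hC, hD, hG, hV, hA', hB', hC', hD', hG', hV', hVsymm⟩
  have hsuff : (∀ᵐ θ ∂(LatticeNet.torusMeasure ν), (P.N θ).PosSemidef) → P.Dissipative := by
    intro hN x₀ u x hu hx
    filter_upwards [hP.ae_dissipationRate_eq hx hu] with t ht
    rw [ht]
    exact hP.dissipationForm_nonneg_of_posSemidef hN _ _
  refine ⟨fun x₀ u x hu hx => ?_, hsuff, fun _ => ⟨fun h => ?_, hsuff⟩⟩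
  · filter_upwards [hP.ae_hasDerivAt_energy hx hu] with t ht
    exact ht.differentiableAt
  · exact hP.posSemidef_of_dissipationForm_nonneg (hP.dissipationForm_nonneg h)
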